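/- **Setting.** Let $\|\cdot\|$ be the Euclidean norm, $\mathbb{R}_-^m$ the nonpositive orthant, $\delta_C$ the indicator function of $C$ ($0$ on $C$, $+\infty$ off $C$), $\psi^*(y)=\sup_x(\langle y,x\rangle-\psi(x))$, $\nabla g(x)=[g'(x)]^\top$, and $u_+=\max\{u,0\}$ (componentwise). For $h:\mathbb{R}^N\to(-\infty,\infty]$ and $x$ with $h(x)$ finite, $\widehat\partial h(x)$ is the set of $v$ with $\liminf_{x'\to x,\,x'\ne x}\frac{h(x')-h(x)-\langle v,x'-x\rangle}{\|x'-x\|}\ge0$, and $\partial h(x)$ is the set of limits of sequences $v^k\in\widehat\partial h(x^k)$ with $x^k\to x$ and $h(x^k)\to h(x)$; both are empty where $h=+\infty$. Write $\mathcal N_C=\partial\delta_C$. A proper $h$ has the *KL property of exponent $q\in[0,1)$* at $\bar x$ if $\partial h(\bar x)\neq\emptyset$ and there are $c,\delta>0$ and $\eta\in(0,\infty]$ such that, with $\varphi(t)=ct^{1-q}$, $\varphi'(h(x)-h(\bar x))\,\mathrm{dist}(0,\partial h(x))\ge1$ for all $x$ with $\|x-\bar x\|\le\delta$ and $h(\bar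 x)<h(x)<h(\bar x)+\eta$ (where $\mathrm{dist}(0,\emptyset)=+\infty$). Consider $\min_x F(x):=f(x)+\phi(x)-\psi(x)+\delta_{\mathbb{R}_-^m}(g(x))$ over $x\in\mathbb{R}^n$, where $g:\mathbb{R}^n\to\mathbb{R}^m$ is differentiable with locally Lipschitz derivative and $\Gamma:=g^{-1}(\mathbb{R}_-^m)\ne\emptyset$; $f:\mathbb{R}^n\to(-\infty,\infty]$ is proper and lower semicontinuous, and is finite and differentiable with locally Lipschitz gradient on an open convex set containing $\Gamma$; $\phi,\psi:\mathbb{R}^n\to\mathbb{R}$ are convex; and $F$ is bounded below on $\Gamma$. Let $$G(x,s,L)=g(s)+g'(s)(x-s)+\tfrac12\|x-s\|^2L .$$ **Inexact moving balls approximation method.** Input: $0<\mu_{\min}\le\mu_{\max}$, $0<L_{\min}\le L_{\max}$, $M,\beta_R,\beta_F,\alpha>0$, $\tau>1$, $x^0\in\Gamma$. For $k=0,1,\dots$ choose $\xi^k\in\partial(-\psi)(x^k)$, $\mu_{k,0}\in[\mu_{\min},\mu_{\max}]$ and $L^{k,0}\in[L_{\min},L_{\max}]^m$. For $j=0,1,\dots$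 choose a self-adjoint linear $\mathcal Q_{k,j}$ with $\mu_{k,j}\mathcal I\preceq\mathcal Q_{k,j}\preceq(\mu_{k,j}+M)\mathcal I$ and put $$\vartheta_{k,j}(x)=f(x^k)-\psi(x^k)+\langle\nabla f(x^k)+\xi^k,x-x^k\rangle+\tfrac12\langle x-x^k,\mathcal Q_{k,j}(x-x^k)\rangle,\qquad F_{k,j}=\vartheta_{k,j}+\phi .$$ Let $\bar x^{k,j}$ be the minimizer of $F_{k,j}$ over $\{x: G(x,x^k,L^{k,j})\le0\}$. Find $y^{k,j}$, $v^{k,j}\in\partial\phi(y^{k,j})$ and $\lambda^{k,j}\in\mathbb{R}_+^m$ with $$R_{k,j}(y^{k,j},v^{k,j},\lambda^{k,j})\le\tfrac{\beta_R}2\|y^{k,j}-x^k\|^2,\quad F_{k,j}(y^{k,j})\le F_{k,j}(x^k),\quad F_{k,j}(y^{k,j})-F_{k,j}(\bar x^{k,j})\le\tfrac{\beta_F}2\|y^{k,j}-x^k\|^2,$$ where, with $r=\nabla\vartheta_{k,j}(x)+v+\nabla_xG(x,x^k,L^{k,j})\lambda$, $$R_{k,j}(x,v,\lambda)=\langle x,r\rangle_++\big(-\langle\lambda,G(x,x^k,L^{k,j})\rangle\big)_++\|r\|+\big\|[G(x,x^k,L^{k,j})]_+\big\|_\infty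 .$$ If $g(y^{k,j})\le0$ and $F(y^{k,j})\le F(x^k)-\frac\alpha2\|y^{k,j}-x^k\|^2$, stop the inner loop with $j_k=j$. Otherwise, if $g(y^{k,j})\not\le0$, set $L^{k,j+1}=\tau L^{k,j}$, $\mu_{k,j+1}=\mu_{k,j}$; else set $L^{k,j+1}=L^{k,j}$, $\mu_{k,j+1}=\tau\mu_{k,j}$. After the inner loop put $x^{k+1}=y^{k,j_k}$, $\bar x^k=\bar x^{k,j_k}$, $L^k=L^{k,j_k}$. Given an infinite run of the method, let $Z^*$ be the set of cluster points of the sequence $z^k=(\bar x^k,x^k,L^k,\xi^k)$. For $x,s,\xi\in\mathbb{R}^n$, $L\in\mathbb{R}_{++}^m$ and $\omega\in\mathbb{R}^m$ define $$\Phi(x,s,L,\xi)=f(x)+\phi(x)+\delta_{\mathbb{R}_-^m}(G(x,s,L))+\langle x,\xi\rangle+\psi^*(-\xi),$$ $$h(x,\omega,\xi)=f(x)+\phi(x)+\delta_{\mathbb{R}_-^m}(\omega)+\langle x,\xi\rangle+\psi^*(-\xi)$$ (with $\Phi=+\infty$ when $L\notin\mathbb{R}_{++}^m$). **Proposition.**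 Let $\bar z=(\bar x,\bar s,\bar L,\bar\xi)\in Z^*$, let $g$ be twice continuously differentiable at $\bar x$ (that is, $C^2$ on a neighbourhood of $\bar x$), and let $q\in[1/2,1)$ be such that $h$ has the KL property of exponent $q$ at $(\bar x,g(\bar x),\bar\xi)$. If $$\{(u,\lambda)\in\mathbb{R}^n\times\mathbb{R}^m : u+\nabla g(\bar x)\lambda=0\}\cap\big[\mathbb{R}^n\times\mathcal N_{\mathbb{R}_-^m}(g(\bar x))\big]=\{(0,0)\},$$ then $\Phi$ has the KL property of exponent $q$ at $\bar z$. -/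

import Mathlib

open Filter Topology Set

noncomputable section

namespace IMBA

/-! ### Variational analysis on a Euclidean space

Extended real-valued functions are modelled as maps into `EReal`. -/

section Variational

variable {V : Type*} [NormedAddCommGroup V] [InnerProductSpace ℝ V]

/-- A proper function: it never takes the value `-∞` and is somewhere finite. -/
def IsProper (h : V → EReal) : Prop :=
  (∀ x, h x ≠ ⊥) ∧ ∃ x, h x ≠ ⊤

/-- Indicator function of a set: `0` on the set and `+∞` off it. -/
def indicatorFn (C : Set V) (x : V) : EReal :=
  open Classical in if x ∈ C then 0 else ⊤

/-- Conjugate function `y ↦ sup_x (⟪y, x⟫ - ψ x)` of a finite function. -/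
def conjugate (ψ : V → ℝ) (y : V) : EReal :=
  ⨆ x : V, ((inner ℝ y x - ψ x : ℝ) : EReal)

/-- Regular (Fréchet) subdifferential at a point of the domain:
`h x' ≥ h x + ⟪v, x' - x⟫ + o(‖x' - x‖)` as `x' → x`, that is,
`liminf (h x' - h x - ⟪v, x' - x⟫) / ‖x' - x‖ ≥ 0` as `x' → x`, `x' ≠ x`.
It is empty outside the domain. -/
def regularSubdiff (h : V → EReal) (x : V) : Set V :=
  {v | h x ≠ ⊤ ∧ h x ≠ ⊥ ∧ ∀ ε : ℝ, 0 < ε → ∀ᶠ x' in 𝓝 x,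
    (((h x).toReal + inner ℝ v (x' - x) - ε * ‖x' - x‖ : ℝ) : EReal) ≤ h x'}

/-- Basic (limiting, Mordukhovich) subdifferential; empty outside the domain. -/
def limitingSubdiff (h : V → EReal) (x : V) : Set V :=
  {v | h x ≠ ⊤ ∧ h x ≠ ⊥ ∧ ∃ (xs vs : ℕ → V),
    Tendsto xs atTop (𝓝 x) ∧ Tendsto (fun k => h (xs k)) atTop (𝓝 (h x)) ∧
    (∀ k, vs k ∈ regularSubdiff h (xs k)) ∧ Tendsto vs atTop (𝓝 v)}

/-- Limiting normal cone: the limiting subdifferential of the indicator function. -/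
def normalCone (C : Set V) (x : V) : Set V :=
  limitingSubdiff (indicatorFn C) x

/-- The Kurdyka-Łojasiewicz inequality at `xbar` with desingularizing function `θ`, on the part
of the closed ball of radius `δ` where `h xbar < h x < h xbar + η`. The distance from `0` to an
empty subdifferential is `+∞`. -/
def KLInequality (h : V → EReal) (xbar : V) (θ : ℝ → ℝ) (δ : ℝ) (η : EReal) : Prop :=
  ∀ x ∈ Metric.closedBall xbar δ, h xbar < h x → h x < h xbar + η →
    1 ≤ ENNReal.ofReal (deriv θ ((h x).toReal - (h xbar).toReal)) *
      Metric.infEDist 0 (limitingSubdiff h x)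

/-- The proper function `h` has the KL property of exponent `q` at `xbar ∈ dom ∂h`: the
desingularizing function can be chosen as `t ↦ c t ^ (1 - q)` with `c > 0`. -/
def HasKLExponent (h : V → EReal) (q : ℝ) (xbar : V) : Prop :=
  IsProper h ∧ (limitingSubdiff h xbar).Nonempty ∧
    ∃ c δ : ℝ, ∃ η : EReal, 0 < c ∧ 0 < δ ∧ 0 < η ∧
      KLInequality h xbar (fun t => c * t ^ (1 - q)) δ η

end Variational

/-! ### The constrained DC problem -/

/-- `ℝⁿ` with its Euclidean norm. -/
abbrev E (n : ℕ) := EuclideanSpace ℝ (Fin n)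

/-- The nonpositive orthant. -/
def nonposOrthant (m : ℕ) : Set (E m) := {w | ∀ i, w i ≤ 0}

section Problem

variable {n m : ℕ}

/-- The feasible set `g⁻¹(ℝ₋ᵐ)`. -/
def feasibleSet (g : E n → E m) : Set (E n) := g ⁻¹' nonposOrthant m

/-- The transposed Jacobian of a mapping at a point. -/
def gradMap (g : E n → E m) (x : E n) : E m →L[ℝ] E n :=
  ContinuousLinearMap.adjoint (fderiv ℝ g x)

/-- The objective `F = f + φ - ψ + δ_{ℝ₋ᵐ} ∘ g`. -/
def objective (f : E n → EReal) (φ ψ : E n → ℝ) (g : E n → E m) (x : E n) : EReal :=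
  f x + ((φ x - ψ x : ℝ) : EReal) + indicatorFn (nonposOrthant m) (g x)

/-- Gradient of an extended real-valued function (used only where it is finite near the point). -/
def gradE (f : E n → EReal) (x : E n) : E n := gradient (fun u => (f u).toReal) x

/-- `f` is finite and differentiable with locally Lipschitz gradient on the (open) set `O`. -/
def IsC11On (f : E n → EReal) (O : Set (E n)) : Prop :=
  (∀ x ∈ O, f x ≠ ⊤ ∧ f x ≠ ⊥) ∧
  (∀ x ∈ O, DifferentiableAt ℝ (fun u => (f u).toReal) x) ∧
  LocallyLipschitzOn O (gradE f)

/-- The basic conditions on the data of the problem. -/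
structure BasicAssumption (f : E n → EReal) (φ ψ : E n → ℝ) (g : E n → E m) : Prop where
  g_diff : Differentiable ℝ g
  g_lip : LocallyLipschitz (fderiv ℝ g)
  feasible : (feasibleSet g).Nonempty
  f_proper : IsProper f
  f_lsc : LowerSemicontinuous f
  f_C11 : ∃ O : Set (E n), IsOpen O ∧ Convex ℝ O ∧ feasibleSet g ⊆ O ∧ IsC11On f O
  phi_convex : ConvexOn ℝ univ φ
  psi_convex : ConvexOn ℝ univ ψ
  bounded_below : ∃ b : ℝ, ∀ x ∈ feasibleSet g, (b : EReal) ≤ objective f φ ψ g x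

/-! ### The inexact moving balls approximation method -/

/-- `G(x, s, L) = g(s) + g'(s)(x - s) + ½ ‖x - s‖² L`. -/
def Gmap (g : E n → E m) (x s : E n) (L : E m) : E m :=
  g s + fderiv ℝ g s (x - s) + ((1 / 2 : ℝ) * ‖x - s‖ ^ 2) • L

/-- The quadratic model of `f - ψ` at `s`, with metric `Q` and `ξ` replacing the gradient of `-ψ`;
used only at points `s` where `f` is finite. -/
def model (f : E n → EReal) (ψ : E n → ℝ) (s ξ : E n) (Q : E n →L[ℝ] E n) (x : E n) : ℝ :=
  inner ℝ (gradE f s + ξ) (x - s) + (1 / 2) * inner ℝ (x - s) (Q (x - s)) + (f s).toReal - ψ s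

/-- Feasible set of the subproblem. -/
def subFeasible (g : E n → E m) (s : E n) (L : E m) : Set (E n) :=
  {x | Gmap g x s L ∈ nonposOrthant m}

/-- Objective of the subproblem. -/
def subObjective (f : E n → EReal) (φ ψ : E n → ℝ) (s ξ : E n) (Q : E n →L[ℝ] E n)
    (x : E n) : ℝ :=
  model f ψ s ξ Q x + φ x

/-- The vector `∇ϑ(x) + v + ∇ₓG(x, s, L) λ`. -/
def kktVector (f : E n → EReal) (ψ : E n → ℝ) (g : E n → E m) (s ξ : E n)
    (Q : E n →L[ℝ] E n) (L : E m) (x v : E n) (lam : E m) : E n :=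
  gradient (model f ψ s ξ Q) x + v + gradMap (fun u => Gmap g u s L) x lam

/-- KKT residual of the subproblem; the last term is the sup norm of the positive part. -/
def kktResidual (f : E n → EReal) (ψ : E n → ℝ) (g : E n → E m) (s ξ : E n)
    (Q : E n →L[ℝ] E n) (L : E m) (x v : E n) (lam : E m) : ℝ :=
  max (inner ℝ x (kktVector f ψ g s ξ Q L x v lam)) 0 +
  max (-inner ℝ lam (Gmap g x s L)) 0 +
  ‖kktVector f ψ g s ξ Q L x v lam‖ +
  ‖(fun i => max (Gmap g x s L i) 0 : Fin m → ℝ)‖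

/-- Input parameters of the method. -/
structure Params where
  muMin : ℝ
  muMax : ℝ
  Lmin : ℝ
  Lmax : ℝ
  M : ℝ
  betaR : ℝ
  betaF : ℝ
  alpha : ℝ
  tau : ℝ
  muMin_pos : 0 < muMin
  muMin_le : muMin ≤ muMax
  Lmin_pos : 0 < Lmin
  Lmin_le : Lmin ≤ Lmax
  M_pos : 0 < M
  betaR_pos : 0 < betaR
  betaF_pos : 0 < betaF
  alpha_pos : 0 < alpha
  tau_gt : 1 < tau

/-- Acceptance test of a trial point `y` at the current iterate `x`. -/
def Accepts (f : E n → EReal) (φ ψ : E n → ℝ) (g : E n → E m) (p : Params) (x y : E n) : Prop :=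
  g y ∈ nonposOrthant m ∧
    objective f φ ψ g y ≤
      objective f φ ψ g x - ((p.alpha / 2 * ‖y - x‖ ^ 2 : ℝ) : EReal)

/-- An (infinite) run of the inexact moving balls approximation method. In the `k`-th outer
iteration the inner loop goes through `j = 0, …, jlast k`; the inner data with `j > jlast k` are
irrelevant. -/
structure Run (f : E n → EReal) (φ ψ : E n → ℝ) (g : E n → E m) (p : Params) where
  /-- outer iterates -/
  x : ℕ → E n
  /-- chosen subgradients of `-ψ` -/
  xi : ℕ → E n
  /-- index at which the inner loop stops -/
  jlast : ℕ → ℕ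
  mu : ℕ → ℕ → ℝ
  L : ℕ → ℕ → E m
  Q : ℕ → ℕ → E n →L[ℝ] E n
  /-- exact solutions of the subproblems -/
  xbar : ℕ → ℕ → E n
  /-- inexact solutions of the subproblems -/
  y : ℕ → ℕ → E n
  v : ℕ → ℕ → E n
  lam : ℕ → ℕ → E m
  init : x 0 ∈ feasibleSet g
  xi_mem : ∀ k, xi k ∈ limitingSubdiff (fun u => ((-ψ u : ℝ) : EReal)) (x k)
  mu_init : ∀ k, mu k 0 ∈ Icc p.muMin p.muMax
  L_init : ∀ k i, L k 0 i ∈ Icc p.Lmin p.Lmax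
  Q_lower : ∀ k, ∀ j ≤ jlast k, (Q k j - mu k j • ContinuousLinearMap.id ℝ (E n)).IsPositive
  Q_upper : ∀ k, ∀ j ≤ jlast k,
    ((mu k j + p.M) • ContinuousLinearMap.id ℝ (E n) - Q k j).IsPositive
  xbar_mem : ∀ k, ∀ j ≤ jlast k, xbar k j ∈ subFeasible g (x k) (L k j)
  xbar_min : ∀ k, ∀ j ≤ jlast k,
    IsMinOn (subObjective f φ ψ (x k) (xi k) (Q k j)) (subFeasible g (x k) (L k j)) (xbar k j)
  v_mem : ∀ k, ∀ j ≤ jlast k, v k j ∈ limitingSubdiff (fun u => (φ u : EReal)) (y k j)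
  lam_nonneg : ∀ k, ∀ j ≤ jlast k, ∀ i, 0 ≤ lam k j i
  inexact_residual : ∀ k, ∀ j ≤ jlast k,
    kktResidual f ψ g (x k) (xi k) (Q k j) (L k j) (y k j) (v k j) (lam k j) ≤
      p.betaR / 2 * ‖y k j - x k‖ ^ 2
  inexact_decrease : ∀ k, ∀ j ≤ jlast k,
    subObjective f φ ψ (x k) (xi k) (Q k j) (y k j) ≤
      subObjective f φ ψ (x k) (xi k) (Q k j) (x k)
  inexact_gap : ∀ k, ∀ j ≤ jlast k,
    subObjective f φ ψ (x k) (xi k) (Q k j) (y k j) -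
      subObjective f φ ψ (x k) (xi k) (Q k j) (xbar k j) ≤
        p.betaF / 2 * ‖y k j - x k‖ ^ 2
  reject : ∀ k, ∀ j < jlast k, ¬ Accepts f φ ψ g p (x k) (y k j)
  update_L : ∀ k, ∀ j < jlast k, g (y k j) ∉ nonposOrthant m →
    L k (j + 1) = p.tau • L k j ∧ mu k (j + 1) = mu k j
  update_mu : ∀ k, ∀ j < jlast k, g (y k j) ∈ nonposOrthant m →
    L k (j + 1) = L k j ∧ mu k (j + 1) = p.tau * mu k j
  accept : ∀ k, Accepts f φ ψ g p (x k) (y k (jlast k))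
  x_succ : ∀ k, x (k + 1) = y k (jlast k)

/-! ### The potential function and its cluster points -/

/-- The Euclidean space `ℝⁿ × ℝⁿ × ℝᵐ × ℝⁿ`. -/
abbrev ZSpace (n m : ℕ) := WithLp 2 (E n × WithLp 2 (E n × WithLp 2 (E m × E n)))

/-- The point `(x, s, L, ξ)`. -/
def mkZ (x s : E n) (L : E m) (ξ : E n) : ZSpace n m :=
  WithLp.toLp 2 (x, WithLp.toLp 2 (s, WithLp.toLp 2 (L, ξ)))

/-- The Euclidean space `ℝⁿ × ℝᵐ × ℝⁿ`. -/
abbrev HSpace (n m : ℕ) := WithLp 2 (E n × WithLp 2 (E m × E n))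

/-- The point `(x, ω, ξ)`. -/
def mkH (x : E n) (ω : E m) (ξ : E n) : HSpace n m :=
  WithLp.toLp 2 (x, WithLp.toLp 2 (ω, ξ))

/-- The set of cluster points of the sequence `(x̄ᵏ, xᵏ, Lᵏ, ξᵏ)` of a run. -/
def clusterSet {f : E n → EReal} {φ ψ : E n → ℝ} {g : E n → E m} {p : Params}
    (r : Run f φ ψ g p) : Set (ZSpace n m) :=
  {z | MapClusterPt z atTop
    (fun k => mkZ (r.xbar k (r.jlast k)) (r.x k) (r.L k (r.jlast k)) (r.xi k))}

/-- `f(x) + φ(x) + δ_{G⁻¹(ℝ₋ᵐ)}(x, s, L) + ⟪x, ξ⟫ + ψ*(-ξ)` in terms of the components. -/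
def potentialCore (f : E n → EReal) (φ ψ : E n → ℝ) (g : E n → E m)
    (x s : E n) (L : E m) (ξ : E n) : EReal :=
  f x + (φ x : EReal) + indicatorFn (nonposOrthant m) (Gmap g x s L) +
    ((inner ℝ x ξ : ℝ) : EReal) + conjugate ψ (-ξ)

/-- The potential function, defined for `L ∈ ℝ₊₊ᵐ` (an open condition) and extended by `+∞`. -/
def potential (f : E n → EReal) (φ ψ : E n → ℝ) (g : E n → E m) (z : ZSpace n m) : EReal :=
  open Classical in
  if ∀ i, 0 < z.snd.snd.fst i then
    potentialCore f φ ψ g z.fst z.snd.fst z.snd.snd.fst z.snd.snd.snd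
  else ⊤

/-- `h(x, ω, ξ) = f(x) + φ(x) + δ_{ℝ₋ᵐ}(ω) + ⟪x, ξ⟫ + ψ*(-ξ)`. -/
def outerFn (f : E n → EReal) (φ ψ : E n → ℝ) (w : HSpace n m) : EReal :=
  f w.fst + (φ w.fst : EReal) + indicatorFn (nonposOrthant m) w.snd.fst +
    ((inner ℝ w.fst w.snd.snd : ℝ) : EReal) + conjugate ψ (-w.snd.snd)

end Problem

end IMBA

end

open Filter Topology Set

noncomputable section

namespace IMBA

/-! ### Transfer of subgradients -/

section Transfer

variable {V W : Type*} [NormedAddCommGroup V] [InnerProductSpace ℝ V]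
  [NormedAddCommGroup W] [InnerProductSpace ℝ W]

/-! In the kernel condition `u` is free: every normal `λ` at `g x̄` gives the solution `(-∇g(x̄)λ,
λ)`. Hence the normal cone of the orthant at `g x̄` is trivial, which forces `g x̄ < 0` in every
coordinate (`lt_zero_of_kernel`). At a cluster point `x̄ = s̄` and `L̄ > 0` (`Run.cluster`):
quadratic growth of the subproblem bounds `‖xᵏ - x̄ᵏ‖²` by quantities that vanish with the step. So
`G(x̄, s̄, L̄) = g x̄ < 0`, and by continuity the constraint is inactive near `z̄`. There `Φ`
depends on `(x, ξ)` alone and equals `h(x, ω, ξ)` for any fixed `ω < 0`. The subgradients of both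
functions then correspond by deleting or inserting zero blocks, which does not increase norms, so
the KL inequality transfers with the same `c`, `η` and `q` (`hasKLExponent_potential`). -/

/-- Chain rule for regular subgradients under precomposition with a nonexpansive affine map `B`
whose linear part has an adjoint sending `v` to `v'`. -/
theorem mem_regularSubdiff_of_comp {Φ : V → EReal} {h : W → EReal} {B : W → V} {w : W}
    {v : V} {v' : W} (hadj : ∀ w', inner ℝ v (B w' - B w) = inner ℝ v' (w' - w))
    (hB : ∀ w', ‖B w' - B w‖ ≤ ‖w' - w‖) (hh : h =ᶠ[𝓝 w] Φ ∘ B)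
    (hv : v ∈ regularSubdiff Φ (B w)) : v' ∈ regularSubdiff h w := by
  obtain ⟨h1, h2, h3⟩ := hv
  have hw : h w = Φ (B w) := hh.self_of_nhds
  have hcont : Tendsto B (𝓝 w) (𝓝 (B w)) := by
    rw [tendsto_iff_norm_sub_tendsto_zero]
    refine squeeze_zero (fun _ => norm_nonneg _) hB ?_
    exact tendsto_iff_norm_sub_tendsto_zero.1 tendsto_id
  refine ⟨hw ▸ h1, hw ▸ h2, fun ε hε => ?_⟩
  filter_upwards [hh, hcont.eventually (h3 ε hε)] with w' hw' hle
  rw [hw, hw']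
  refine le_trans (EReal.coe_le_coe_iff.2 ?_) hle
  rw [hadj]
  -- Nonexpansiveness of `B` lets the same `ε` serve both functions.
  have := mul_le_mul_of_nonneg_left (hB w') hε.le
  linarith

/-- A pointwise transfer of regular subgradients near a point, along continuous maps, passes to
limiting subgradients at that point. -/
theorem mem_limitingSubdiff_of_eventually {Φ : V → EReal} {h : W → EReal} {T S : V → W}
    {z v : V} (hT : ContinuousAt T z) (hS : ContinuousAt S v)
    (hΦ : ∀ᶠ z' in 𝓝 z, Φ z' = h (T z') ∧
      ∀ u ∈ regularSubdiff Φ z', S u ∈ regularSubdiff h (T z'))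
    (hv : v ∈ limitingSubdiff Φ z) : S v ∈ limitingSubdiff h (T z) := by
  obtain ⟨h1, h2, xs, vs, hx, hfx, hreg, hvs⟩ := hv
  have hz := hΦ.self_of_nhds.1
  -- The transfer holds only near `z`, whereas the definition asks for every index; dropping the
  -- first `N` terms reconciles the two.
  obtain ⟨N, hN⟩ := eventually_atTop.1 (hx.eventually hΦ)
  have hshift : Tendsto (fun k => k + N) atTop atTop := tendsto_add_atTop_nat N
  refine ⟨hz ▸ h1, hz ▸ h2, fun k => T (xs (k + N)), fun k => S (vs (k + N)),
    hT.tendsto.comp (hx.comp hshift), ?_, fun k => (hN _ (Nat.le_add_left N k)).2 _ (hreg _),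
    hS.tendsto.comp (hvs.comp hshift)⟩
  rw [← hz]
  refine (hfx.comp hshift).congr fun k => ?_
  exact (hN _ (Nat.le_add_left N k)).1

/-- The KL exponent is inherited by a function that near `z` factors through `T`, with its
limiting subgradients dominating those of the outer function. -/
theorem HasKLExponent.of_eventually {Φ : V → EReal} {h : W → EReal} {T : V → W} {S : V → W}
    {z : V} {q : ℝ} (hT : ContinuousAt T z) (hS : ∀ v, ‖S v‖ ≤ ‖v‖)
    (hΦ : ∀ᶠ z' in 𝓝 z, Φ z' = h (T z') ∧
      ∀ u ∈ limitingSubdiff Φ z', S u ∈ limitingSubdiff h (T z'))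
    (hproper : IsProper Φ) (hne : (limitingSubdiff Φ z).Nonempty)
    (hh : HasKLExponent h q (T z)) : HasKLExponent Φ q z := by
  obtain ⟨-, -, c, δ, η, hc, hδ, hη, hKL⟩ := hh
  have hz := hΦ.self_of_nhds.1
  have hball : ∀ᶠ z' in 𝓝 z, T z' ∈ Metric.closedBall (T z) δ :=
    hT.tendsto.eventually (Metric.closedBall_mem_nhds _ hδ)
  obtain ⟨δ', hδ', hsub⟩ := Metric.nhds_basis_closedBall.mem_iff.1 (hΦ.and hball)
  refine ⟨hproper, hne, c, δ', η, hc, hδ', hη, fun z' hz' hlt hlt' => ?_⟩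
  obtain ⟨⟨he, hsd⟩, hb⟩ := hsub hz'
  rw [hz, he] at hlt hlt'
  rw [hz, he]
  refine (hKL _ hb hlt hlt').trans ?_
  gcongr
  -- `S` maps `∂Φ` into `∂h` without increasing norms, so `dist(0, ∂h) ≤ dist(0, ∂Φ)`, also when
  -- `∂Φ` is empty.
  refine Metric.le_infEDist.2 fun u hu => (Metric.infEDist_le_edist_of_mem (hsd u hu)).trans ?_
  rw [edist_zero_left, edist_zero_left]
  exact ENNReal.coe_le_coe.2 (hS u)

end Transfer

/-! ### The nonpositive orthant -/

section Orthant

variable {m : ℕ}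

theorem isClosed_nonposOrthant : IsClosed (nonposOrthant m) := by
  simp only [nonposOrthant, ofPred_forall]
  exact isClosed_iInter fun i => isClosed_le (by fun_prop) continuous_const

/-- At an active coordinate, `⟪eᵢ, w' - w⟫ = w'ᵢ ≤ 0` on the orthant. So `eᵢ` is already a regular
subgradient and constant sequences suffice. -/
theorem single_mem_normalCone {w : E m} (hw : w ∈ nonposOrthant m) {i : Fin m} (hi : w i = 0) :
    EuclideanSpace.single i (1 : ℝ) ∈ normalCone (nonposOrthant m) w := by
  have hw0 : indicatorFn (nonposOrthant m) w = 0 := by simp [indicatorFn, hw]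
  refine ⟨by simp [hw0], by simp [hw0], fun _ => w, fun _ => EuclideanSpace.single i (1 : ℝ),
    tendsto_const_nhds, tendsto_const_nhds, fun _ => ⟨by simp [hw0], by simp [hw0], ?_⟩,
    tendsto_const_nhds⟩
  refine fun ε hε => Eventually.of_forall fun w' => ?_
  by_cases hw' : w' ∈ nonposOrthant m
  · have h0 : indicatorFn (nonposOrthant m) w' = 0 := by simp [indicatorFn, hw']
    rw [h0, hw0, ← EReal.coe_zero, EReal.coe_le_coe_iff, EuclideanSpace.inner_single_left]
    have h1 := hw' i
    have h2 : 0 ≤ ε * ‖w' - w‖ := by positivity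
    simp [hi]
    linarith
  · simp [indicatorFn, hw']

/-- The kernel condition says that the constraint is inactive. -/
theorem lt_zero_of_kernel {n : ℕ} {g : E n → E m} {x : E n} (hx : g x ∈ nonposOrthant m)
    (hker : {u : E n × E m | u.1 + gradMap g x u.2 = 0} ∩
        (univ ×ˢ normalCone (nonposOrthant m) (g x)) = {(0, 0)}) (i : Fin m) : g x i < 0 := by
  refine lt_of_le_of_ne (hx i) fun hi => ?_
  -- The free component `u` is chosen to solve the linear equation for `λ = eᵢ`.
  have hmem : (-gradMap g x (EuclideanSpace.single i (1 : ℝ)), EuclideanSpace.single i (1 : ℝ)) ∈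
      {u : E n × E m | u.1 + gradMap g x u.2 = 0} ∩
        (univ ×ˢ normalCone (nonposOrthant m) (g x)) :=
    ⟨by simp, mem_univ _, single_mem_normalCone hx hi⟩
  rw [hker] at hmem
  simpa using congrArg (fun u : E n × E m => u.2 i) hmem

end Orthant

/-! ### Runs of the method -/

section Method

variable {n m : ℕ}

/-- A decreasing sequence bounded below converges, so its consecutive differences, which dominate `c
* b k ^ 2`, tend to zero. -/
theorem tendsto_zero_of_sq_decrease {a b : ℕ → ℝ} {c C : ℝ} (hc : 0 < c) (ha : ∀ k, C ≤ a k)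
    (hdec : ∀ k, a (k + 1) ≤ a k - c * b k ^ 2) : Tendsto b atTop (𝓝 0) := by
  have hanti : Antitone a := antitone_nat_of_succ_le fun k => by
    have := hdec k
    nlinarith [mul_nonneg hc.le (sq_nonneg (b k))]
  have hlim := tendsto_atTop_ciInf hanti ⟨C, by rintro _ ⟨k, rfl⟩; exact ha k⟩
  have hdiff : Tendsto (fun k => (a k - a (k + 1)) / c) atTop (𝓝 0) := by
    simpa using (hlim.sub (hlim.comp (tendsto_add_atTop_nat 1))).div_const c
  have hsq : Tendsto (fun k => b k ^ 2) atTop (𝓝 0) :=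
    squeeze_zero (fun k => sq_nonneg _)
      (fun k => by rw [le_div_iff₀ hc]; have := hdec k; linarith) hdiff
  have := hsq.sqrt
  simp only [Real.sqrt_sq_eq_abs, Real.sqrt_zero] at this
  exact (tendsto_zero_iff_abs_tendsto_zero b).2 this

theorem objective_eq_coe {f : E n → EReal} {φ ψ : E n → ℝ} {g : E n → E m}
    (hA : BasicAssumption f φ ψ g) {x : E n} (hx : x ∈ feasibleSet g) :
    objective f φ ψ g x = (((f x).toReal + (φ x - ψ x) : ℝ) : EReal) := by
  obtain ⟨O, -, -, hsub, hfin, -⟩ := hA.f_C11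
  have hx' : g x ∈ nonposOrthant m := hx
  obtain ⟨h1, h2⟩ := hfin x (hsub hx)
  rw [objective, indicatorFn, if_pos hx', add_zero, EReal.coe_add, EReal.coe_toReal h1 h2]

theorem subObjective_self (f : E n → EReal) (φ ψ : E n → ℝ) (s ξ : E n) (Q : E n →L[ℝ] E n) :
    subObjective f φ ψ s ξ Q s = (f s).toReal - ψ s + φ s := by
  simp [subObjective, model]

/-- The affine part is exact at the midpoint, the quadratic part contributes exactly the `1/8` term,
and `φ` is convex. -/
theorem subObjective_midpoint_le {f : E n → EReal} {φ ψ : E n → ℝ} (hφ : ConvexOn ℝ univ φ)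
    (s ξ : E n) (Q : E n →L[ℝ] E n) (x y : E n) :
    subObjective f φ ψ s ξ Q ((1 / 2 : ℝ) • x + (1 / 2 : ℝ) • y) ≤
      (1 / 2) * subObjective f φ ψ s ξ Q x + (1 / 2) * subObjective f φ ψ s ξ Q y -
        (1 / 8) * inner ℝ (x - y) (Q (x - y)) := by
  have hconv := hφ.2 (mem_univ x) (mem_univ y) (by norm_num : (0 : ℝ) ≤ 1 / 2)
    (by norm_num : (0 : ℝ) ≤ 1 / 2) (by norm_num)
  have h1 : (1 / 2 : ℝ) • x + (1 / 2 : ℝ) • y - s = (1 / 2 : ℝ) • (x - s) + (1 / 2 : ℝ) • (y - s) := by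
    module
  have h2 : x - y = (x - s) - (y - s) := by abel
  simp only [subObjective, model, h1]
  rw [h2]
  generalize x - s = a at *
  generalize y - s = b at *
  simp only [map_add, map_sub, map_smul, inner_add_left, inner_add_right, inner_sub_left,
    inner_sub_right, inner_smul_left, inner_smul_right, RCLike.conj_to_real, smul_eq_mul] at hconv ⊢
  linarith

theorem Gmap_self (g : E n → E m) (s : E n) (L : E m) : Gmap g s s L = g s := by
  simp [Gmap]

/-- Each coordinate of `G(·, s, L)` is affine plus `Lᵢ/2` times a squared norm, hence convex when
`Lᵢ ≥ 0`. -/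
theorem midpoint_mem_subFeasible {g : E n → E m} {s : E n} {L : E m} (hL : ∀ i, 0 ≤ L i)
    {x y : E n} (hx : x ∈ subFeasible g s L) (hy : y ∈ subFeasible g s L) :
    (1 / 2 : ℝ) • x + (1 / 2 : ℝ) • y ∈ subFeasible g s L := by
  intro i
  have hxi := hx i
  have hyi := hy i
  have h1 : (1 / 2 : ℝ) • x + (1 / 2 : ℝ) • y - s = (1 / 2 : ℝ) • (x - s) + (1 / 2 : ℝ) • (y - s) := by
    module
  simp only [Gmap, h1] at hxi hyi ⊢
  generalize x - s = a at *
  generalize y - s = b at *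
  have hn : ‖(1 / 2 : ℝ) • a + (1 / 2 : ℝ) • b‖ ^ 2 ≤ (1 / 2) * ‖a‖ ^ 2 + (1 / 2) * ‖b‖ ^ 2 := by
    rw [← smul_add, norm_smul, mul_pow]
    have := parallelogram_law_with_norm ℝ a b
    have h3 : ‖(1 / 2 : ℝ)‖ ^ 2 = 1 / 4 := by norm_num
    rw [h3]
    nlinarith [sq_nonneg ‖a - b‖]
  simp only [PiLp.add_apply, PiLp.smul_apply, smul_eq_mul, map_add, map_smul] at hxi hyi ⊢
  have := mul_le_mul_of_nonneg_right hn (hL i)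
  linarith

theorem mul_sq_le_inner {Q : E n →L[ℝ] E n} {μ : ℝ}
    (hQ : (Q - μ • ContinuousLinearMap.id ℝ (E n)).IsPositive) (d : E n) :
    μ * ‖d‖ ^ 2 ≤ inner ℝ d (Q d) := by
  have h : 0 ≤ inner ℝ d (Q d - μ • d) := hQ.inner_nonneg_right d
  rw [inner_sub_right, inner_smul_right, real_inner_self_eq_norm_sq] at h
  linarith

/-- Quadratic growth of the subproblem at its solution. -/
theorem quadratic_growth {f : E n → EReal} {φ ψ : E n → ℝ} (hφ : ConvexOn ℝ univ φ)
    {g : E n → E m} {s ξ : E n} {L : E m} (hL : ∀ i, 0 ≤ L i) {Q : E n →L[ℝ] E n} {μ : ℝ}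
    (hQ : (Q - μ • ContinuousLinearMap.id ℝ (E n)).IsPositive) {x z : E n}
    (hx : x ∈ subFeasible g s L) (hz : z ∈ subFeasible g s L)
    (hmin : IsMinOn (subObjective f φ ψ s ξ Q) (subFeasible g s L) z) :
    μ / 4 * ‖x - z‖ ^ 2 ≤ subObjective f φ ψ s ξ Q x - subObjective f φ ψ s ξ Q z := by
  have h1 := hmin (midpoint_mem_subFeasible hL hx hz)
  have h2 := subObjective_midpoint_le (f := f) (ψ := ψ) hφ s ξ Q x z
  have h3 := mul_sq_le_inner hQ (x - z)
  simp only [mem_ofPred_eq] at h1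
  -- Minimality at the midpoint gives `F z ≤ F x / 2 + F z / 2 - (μ/8)‖x - z‖²`; doubling yields the
  -- constant `μ/4`.
  linarith

/-! ### Bounds and limits along a run -/

variable {f : E n → EReal} {φ ψ : E n → ℝ} {g : E n → E m} {p : Params}

theorem Run.x_mem (r : Run f φ ψ g p) (k : ℕ) : r.x k ∈ feasibleSet g := by
  cases k with
  | zero => exact r.init
  | succ k => rw [r.x_succ]; exact (r.accept k).1

theorem Run.muMin_le_mu (r : Run f φ ψ g p) (k j : ℕ) (hj : j ≤ r.jlast k) :
    p.muMin ≤ r.mu k j := by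
  induction j with
  | zero => exact (r.mu_init k).1
  | succ j ih =>
    have ih := ih (by omega)
    by_cases hg : g (r.y k j) ∈ nonposOrthant m
    · rw [(r.update_mu k j (by omega) hg).2]
      nlinarith [p.tau_gt, p.muMin_pos]
    · rwa [(r.update_L k j (by omega) hg).2]

theorem Run.Lmin_le_L (r : Run f φ ψ g p) (k j : ℕ) (hj : j ≤ r.jlast k) (i : Fin m) :
    p.Lmin ≤ r.L k j i := by
  induction j with
  | zero => exact (r.L_init k i).1
  | succ j ih =>
    have ih := ih (by omega)
    by_cases hg : g (r.y k j) ∈ nonposOrthant m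
    · rwa [(r.update_mu k j (by omega) hg).1]
    · rw [(r.update_L k j (by omega) hg).1, PiLp.smul_apply, smul_eq_mul]
      nlinarith [p.tau_gt, p.Lmin_pos]

theorem Run.tendsto_step (hA : BasicAssumption f φ ψ g) (r : Run f φ ψ g p) :
    Tendsto (fun k => ‖r.y k (r.jlast k) - r.x k‖) atTop (𝓝 0) := by
  obtain ⟨b, hb⟩ := hA.bounded_below
  refine tendsto_zero_of_sq_decrease (c := p.alpha / 2) (C := b)
    (a := fun k => (f (r.x k)).toReal + (φ (r.x k) - ψ (r.x k))) (half_pos p.alpha_pos)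
    (fun k => ?_) fun k => ?_
  · have := hb _ (r.x_mem k)
    rwa [objective_eq_coe hA (r.x_mem k), EReal.coe_le_coe_iff] at this
  · have := (r.accept k).2
    rw [← r.x_succ, objective_eq_coe hA (r.x_mem _), objective_eq_coe hA (r.x_mem _),
      ← EReal.coe_sub, EReal.coe_le_coe_iff] at this
    rwa [← r.x_succ]

/-- Quadratic growth is applied at `xᵏ`, feasible because `G(xᵏ, xᵏ, L) = g(xᵏ)`. The gap `F(xᵏ) -
F(x̄ᵏ)` is split at `yᵏ`: the first part is expanded with its nonpositive quadratic term dropped,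
the second is the inexactness tolerance. -/
theorem Run.sq_dist_le (hA : BasicAssumption f φ ψ g) (r : Run f φ ψ g p) (k : ℕ) :
    p.muMin / 4 * ‖r.x k - r.xbar k (r.jlast k)‖ ^ 2 ≤
      ‖gradE f (r.x k) + r.xi k‖ * ‖r.y k (r.jlast k) - r.x k‖ +
        (φ (r.x k) - φ (r.y k (r.jlast k))) +
        p.betaF / 2 * ‖r.y k (r.jlast k) - r.x k‖ ^ 2 := by
  have hμ := r.muMin_le_mu k _ le_rfl
  have hx : r.x k ∈ subFeasible g (r.x k) (r.L k (r.jlast k)) := by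
    have : g (r.x k) ∈ nonposOrthant m := r.x_mem k
    simpa [subFeasible, Gmap_self] using this
  have h1 := quadratic_growth hA.phi_convex
    (fun i => p.Lmin_pos.le.trans (r.Lmin_le_L k _ le_rfl i)) (r.Q_lower k _ le_rfl) hx
    (r.xbar_mem k _ le_rfl) (r.xbar_min k _ le_rfl)
  have h2 := r.inexact_gap k _ le_rfl
  have h3 := mul_sq_le_inner (r.Q_lower k _ le_rfl) (r.y k (r.jlast k) - r.x k)
  have h4 := neg_le_of_abs_le
    (abs_real_inner_le_norm (gradE f (r.x k) + r.xi k) (r.y k (r.jlast k) - r.x k))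
  have h5 : 0 ≤ r.mu k (r.jlast k) * ‖r.y k (r.jlast k) - r.x k‖ ^ 2 :=
    mul_nonneg (p.muMin_pos.le.trans hμ) (sq_nonneg _)
  have h6 := mul_le_mul_of_nonneg_right hμ (sq_nonneg ‖r.x k - r.xbar k (r.jlast k)‖)
  have h7 := subObjective_self f φ ψ (r.x k) (r.xi k) (r.Q k (r.jlast k))
  have h8 : subObjective f φ ψ (r.x k) (r.xi k) (r.Q k (r.jlast k)) (r.y k (r.jlast k)) =
    inner ℝ (gradE f (r.x k) + r.xi k) (r.y k (r.jlast k) - r.x k) +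
      (1 / 2) * inner ℝ (r.y k (r.jlast k) - r.x k)
        (r.Q k (r.jlast k) (r.y k (r.jlast k) - r.x k)) + (f (r.x k)).toReal - ψ (r.x k) +
      φ (r.y k (r.jlast k)) := rfl
  linarith

/-- At a cluster point the first two blocks coincide, they are feasible, and `L` is positive. -/
theorem Run.cluster (hA : BasicAssumption f φ ψ g) (r : Run f φ ψ g p) {xb sb : E n} {Lb : E m}
    {ξb : E n} (hz : mkZ xb sb Lb ξb ∈ clusterSet r) :
    xb = sb ∧ sb ∈ feasibleSet g ∧ ∀ i, 0 < Lb i := by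
  -- Along an ultrafilter finer than `atTop` all four blocks converge, and limits along `atTop`
  -- remain available.
  obtain ⟨U, hU, hlim⟩ := mapClusterPt_iff_ultrafilter.1 hz
  have hxbar : Tendsto (fun k => r.xbar k (r.jlast k)) U (𝓝 xb) :=
    ((WithLp.continuous_fst 2 _ _).tendsto _).comp hlim
  have hlim2 := ((WithLp.continuous_snd 2 _ _).tendsto _).comp hlim
  have hx : Tendsto r.x U (𝓝 sb) := ((WithLp.continuous_fst 2 _ _).tendsto _).comp hlim2
  have hlim3 := ((WithLp.continuous_snd 2 _ _).tendsto _).comp hlim2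
  have hL : Tendsto (fun k => r.L k (r.jlast k)) U (𝓝 Lb) :=
    ((WithLp.continuous_fst 2 _ _).tendsto _).comp hlim3
  have hξ : Tendsto r.xi U (𝓝 ξb) := ((WithLp.continuous_snd 2 _ _).tendsto _).comp hlim3
  have hsb : sb ∈ feasibleSet g :=
    (isClosed_nonposOrthant.preimage hA.g_diff.continuous).mem_of_tendsto hx
      (Eventually.of_forall r.x_mem)
  refine ⟨?_, hsb, fun i => ?_⟩
  · have hstep := (r.tendsto_step hA).mono_left hU
    have hy : Tendsto (fun k => r.y k (r.jlast k)) U (𝓝 sb) := by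
      have h0 := tendsto_zero_iff_norm_tendsto_zero.2 hstep
      simpa using h0.add hx
    have hφ := hA.phi_convex.locallyLipschitz.continuous
    obtain ⟨O, hO, -, hsub, -, -, hlip⟩ := hA.f_C11
    have hgrad : ContinuousAt (gradE f) sb :=
      hlip.continuousOn.continuousAt (hO.mem_nhds (hsub hsb))
    -- The whole right side of `Run.sq_dist_le` tends to zero: `∇f(xᵏ) + ξᵏ` converges, the step
    -- vanishes, and `φ` is continuous.
    have hR := ((((hgrad.tendsto.comp hx).add hξ).norm.mul hstep).add
      (((hφ.tendsto _).comp hx).sub ((hφ.tendsto _).comp hy))).add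
      ((hstep.pow 2).const_mul (p.betaF / 2))
    have hD := (((hx.sub hxbar).norm.pow 2).const_mul (p.muMin / 4))
    have hle := le_of_tendsto_of_tendsto' hD hR (r.sq_dist_le hA)
    simp only [mul_zero, sub_self, add_zero, ne_eq, OfNat.ofNat_ne_zero, not_false_eq_true,
      zero_pow] at hle
    have h0 : ‖sb - xb‖ ^ 2 ≤ 0 := by
      by_contra hpos
      have := mul_pos (div_pos p.muMin_pos four_pos) (not_le.1 hpos)
      linarith
    have h1 : ‖sb - xb‖ = 0 := pow_eq_zero_iff two_ne_zero |>.1 (le_antisymm h0 (sq_nonneg _))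
    exact (sub_eq_zero.1 (norm_eq_zero.1 h1)).symm
  · have hLi : Tendsto (fun k => r.L k (r.jlast k) i) U (𝓝 (Lb i)) :=
      ((by fun_prop : Continuous fun L : E m => L i).tendsto _).comp hL
    exact p.Lmin_pos.trans_le (ge_of_tendsto' hLi fun k => r.Lmin_le_L k _ le_rfl i)

end Method

/-! ### The potential near points where the constraint is inactive -/

section Potential

variable {n m : ℕ}

/-- `(x, s, L, ξ) ↦ (x, ω, ξ)`. -/
def dropSL (ω : E m) (z : ZSpace n m) : HSpace n m := mkH z.fst ω z.snd.snd.snd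

/-- `(x, ω, ξ) ↦ (x, s, L, ξ)`. -/
def insertSL (s : E n) (L : E m) (w : HSpace n m) : ZSpace n m := mkZ w.fst s L w.snd.snd

theorem continuous_dropSL (ω : E m) : Continuous (dropSL (n := n) ω) := by
  have h1 : Continuous fun z : ZSpace n m => z.fst := WithLp.continuous_fst 2 _ _
  have h2 : Continuous fun z : ZSpace n m => z.snd := WithLp.continuous_snd 2 _ _
  have h3 : Continuous fun z : ZSpace n m => z.snd.snd := (WithLp.continuous_snd 2 _ _).comp h2
  have h4 : Continuous fun z : ZSpace n m => z.snd.snd.snd :=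
    (WithLp.continuous_snd 2 _ _).comp h3
  exact (WithLp.prod_continuous_toLp 2 _ _).comp
    (h1.prodMk ((WithLp.prod_continuous_toLp 2 _ _).comp (continuous_const.prodMk h4)))

theorem continuous_insertSL (s : E n) (L : E m) : Continuous (insertSL s L) := by
  have h1 : Continuous fun z : HSpace n m => z.fst := WithLp.continuous_fst 2 _ _
  have h2 : Continuous fun z : HSpace n m => z.snd := WithLp.continuous_snd 2 _ _
  have h3 : Continuous fun z : HSpace n m => z.snd.snd := (WithLp.continuous_snd 2 _ _).comp h2
  exact (WithLp.prod_continuous_toLp 2 _ _).comp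
    (h1.prodMk ((WithLp.prod_continuous_toLp 2 _ _).comp
      (continuous_const.prodMk ((WithLp.prod_continuous_toLp 2 _ _).comp
        (continuous_const.prodMk h3)))))

theorem norm_dropSL_le (z : ZSpace n m) : ‖dropSL (0 : E m) z‖ ≤ ‖z‖ := by
  refine le_of_sq_le_sq ?_ (norm_nonneg _)
  simp only [WithLp.prod_norm_sq_eq_of_L2, dropSL, mkH, WithLp.toLp_fst, WithLp.toLp_snd, norm_zero]
  nlinarith [sq_nonneg ‖z.snd.fst‖, sq_nonneg ‖z.snd.snd.fst‖]

theorem norm_insertSL_le (w : HSpace n m) : ‖insertSL (0 : E n) (0 : E m) w‖ ≤ ‖w‖ := by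
  refine le_of_sq_le_sq ?_ (norm_nonneg _)
  simp only [WithLp.prod_norm_sq_eq_of_L2, insertSL, mkZ, WithLp.toLp_fst, WithLp.toLp_snd,
    norm_zero]
  nlinarith [sq_nonneg ‖w.snd.fst‖]

theorem dropSL_sub (ω : E m) (z z' : ZSpace n m) :
    dropSL ω z' - dropSL ω z = dropSL 0 (z' - z) := by
  simp only [dropSL, mkH, ← WithLp.toLp_sub, Prod.mk_sub_mk, sub_self]
  rfl

theorem insertSL_sub (s : E n) (L : E m) (w w' : HSpace n m) :
    insertSL s L w' - insertSL s L w = insertSL 0 0 (w' - w) := by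
  simp only [insertSL, mkZ, ← WithLp.toLp_sub, Prod.mk_sub_mk, sub_self]
  rfl

/-- The linear parts of inserting and deleting blocks are mutually adjoint; this supplies the
adjoint identity in `mem_regularSubdiff_of_comp`. -/
theorem inner_insertSL (v : ZSpace n m) (w : HSpace n m) :
    inner ℝ v (insertSL 0 0 w) = inner ℝ (dropSL 0 v) w := by
  simp [WithLp.prod_inner_apply, insertSL, dropSL, mkZ, mkH]

theorem inner_dropSL (v : HSpace n m) (z : ZSpace n m) :
    inner ℝ v (dropSL 0 z) = inner ℝ (insertSL 0 0 v) z := by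
  simp [WithLp.prod_inner_apply, insertSL, dropSL, mkZ, mkH]

/-- The points with `L ∈ ℝ₊₊ᵐ` at which the constraint `G(x, s, L) ≤ 0` is inactive. -/
def inactiveSet (g : E n → E m) : Set (ZSpace n m) :=
  {z | (∀ i, 0 < z.snd.snd.fst i) ∧ ∀ i, Gmap g z.fst z.snd.fst z.snd.snd.fst i < 0}

theorem isOpen_inactiveSet {g : E n → E m} (hg : Continuous g) (hg' : Continuous (fderiv ℝ g)) :
    IsOpen (inactiveSet g) := by
  have h1 : Continuous fun z : ZSpace n m => z.fst := WithLp.continuous_fst 2 _ _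
  have h2 : Continuous fun z : ZSpace n m => z.snd := WithLp.continuous_snd 2 _ _
  have h3 : Continuous fun z : ZSpace n m => z.snd.fst := (WithLp.continuous_fst 2 _ _).comp h2
  have h4 : Continuous fun z : ZSpace n m => z.snd.snd := (WithLp.continuous_snd 2 _ _).comp h2
  have h5 : Continuous fun z : ZSpace n m => z.snd.snd.fst :=
    (WithLp.continuous_fst 2 _ _).comp h4
  have hG : Continuous fun z : ZSpace n m => Gmap g z.fst z.snd.fst z.snd.snd.fst :=
    ((hg.comp h3).add ((hg'.comp h3).clm_apply (h1.sub h3))).add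
      ((continuous_const.mul ((h1.sub h3).norm.pow 2)).smul h5)
  have hap : ∀ i : Fin m, Continuous fun L : E m => L i := fun i => by fun_prop
  simp only [inactiveSet, ofPred_and, ofPred_forall]
  exact (isOpen_iInter_of_finite fun i => isOpen_lt continuous_const ((hap i).comp h5)).inter
    (isOpen_iInter_of_finite fun i => isOpen_lt ((hap i).comp hG) continuous_const)

theorem eventually_neg_of_neg {w : HSpace n m} (hw : ∀ i, w.snd.fst i < 0) :
    ∀ᶠ w' in 𝓝 w, ∀ i, w'.snd.fst i < 0 := by
  have hc : Continuous fun w : HSpace n m => w.snd.fst :=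
    (WithLp.continuous_fst 2 _ _).comp (WithLp.continuous_snd 2 _ _)
  exact eventually_all.2 fun i =>
    ((by fun_prop : Continuous fun L : E m => L i).comp hc).continuousAt.eventually_lt_const
      (hw i)

variable {f : E n → EReal} {φ ψ : E n → ℝ} {g : E n → E m}

theorem outerFn_congr {x ξ : E n} {ω ω' : E m} (h : ω ∈ nonposOrthant m)
    (h' : ω' ∈ nonposOrthant m) :
    outerFn f φ ψ (mkH x ω ξ) = outerFn f φ ψ (mkH x ω' ξ) := by
  simp [outerFn, mkH, indicatorFn, h, h']

theorem potential_of_pos {z : ZSpace n m} (hz : ∀ i, 0 < z.snd.snd.fst i) :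
    potential f φ ψ g z =
      outerFn f φ ψ (mkH z.fst (Gmap g z.fst z.snd.fst z.snd.snd.fst) z.snd.snd.snd) := by
  rw [potential, if_pos hz]
  rfl

theorem potential_eq_outerFn_dropSL {z : ZSpace n m} (hz : z ∈ inactiveSet g) {ω : E m}
    (hω : ω ∈ nonposOrthant m) : potential f φ ψ g z = outerFn f φ ψ (dropSL ω z) := by
  rw [potential_of_pos hz.1]
  exact outerFn_congr (fun i => (hz.2 i).le) hω

/-- With `s` and `L` frozen at their values in `z`, `h` is locally `Φ` composed with `insertSL`, to
which the chain rule applies. -/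
theorem dropSL_mem_regularSubdiff (hU : IsOpen (inactiveSet g)) {z : ZSpace n m}
    (hz : z ∈ inactiveSet g) {ω : E m} (hω : ∀ i, ω i < 0) {v : ZSpace n m}
    (hv : v ∈ regularSubdiff (potential f φ ψ g) z) :
    dropSL 0 v ∈ regularSubdiff (outerFn f φ ψ) (dropSL ω z) := by
  refine mem_regularSubdiff_of_comp (Φ := potential f φ ψ g) (v := v)
    (B := insertSL z.snd.fst z.snd.snd.fst)
    (fun w' => by rw [insertSL_sub, inner_insertSL])
    (fun w' => by rw [insertSL_sub]; exact norm_insertSL_le _) ?_ hv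
  have h1 : ∀ᶠ w in 𝓝 (dropSL ω z), insertSL z.snd.fst z.snd.snd.fst w ∈ inactiveSet g :=
    (continuous_insertSL _ _).continuousAt.eventually (hU.mem_nhds hz)
  -- Strict negativity of `ω` keeps the indicator zero around it, which is why the `ω`-block of the
  -- subgradient can be `0`.
  have h2 := eventually_neg_of_neg (w := dropSL ω z) hω
  filter_upwards [h1, h2] with w hw1 hw2
  exact (potential_eq_outerFn_dropSL hw1 fun i => (hw2 i).le).symm

/-- The converse transfer; it serves to make `∂Φ` nonempty at the reference point. -/
theorem insertSL_mem_regularSubdiff (hU : IsOpen (inactiveSet g)) {s : E n} {L : E m}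
    {w : HSpace n m} (hw : insertSL s L w ∈ inactiveSet g) (hω : w.snd.fst ∈ nonposOrthant m)
    {v : HSpace n m} (hv : v ∈ regularSubdiff (outerFn f φ ψ) w) :
    insertSL 0 0 v ∈ regularSubdiff (potential f φ ψ g) (insertSL s L w) := by
  refine mem_regularSubdiff_of_comp (Φ := outerFn f φ ψ) (v := v) (B := dropSL w.snd.fst)
    (fun z' => by rw [dropSL_sub, inner_dropSL])
    (fun z' => by rw [dropSL_sub]; exact norm_dropSL_le _) ?_ hv
  filter_upwards [hU.mem_nhds hw] with z hz
  exact potential_eq_outerFn_dropSL hz hω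

theorem isProper_potential (hh : ∀ w : HSpace n m, outerFn f φ ψ w ≠ ⊥)
    (hfin : ∃ z, potential f φ ψ g z ≠ ⊤) : IsProper (potential f φ ψ g) := by
  refine ⟨fun z => ?_, hfin⟩
  by_cases hz : ∀ i, 0 < z.snd.snd.fst i
  · rw [potential_of_pos hz]
    exact hh _
  · simp [potential, hz]

/-- The KL exponent passes from the outer function to the potential where the constraint is
inactive. -/
theorem hasKLExponent_potential (hU : IsOpen (inactiveSet g)) {z : ZSpace n m}
    (hz : z ∈ inactiveSet g) {ω : E m} (hω : ∀ i, ω i < 0) {q : ℝ}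
    (hh : HasKLExponent (outerFn f φ ψ) q (dropSL ω z)) :
    HasKLExponent (potential f φ ψ g) q z := by
  have hω' : ω ∈ nonposOrthant m := fun i => (hω i).le
  have hne : (limitingSubdiff (potential f φ ψ g) z).Nonempty := by
    obtain ⟨v, hv⟩ := hh.2.1
    refine ⟨insertSL 0 0 v, mem_limitingSubdiff_of_eventually
      (T := insertSL z.snd.fst z.snd.snd.fst) (continuous_insertSL _ _).continuousAt
      (continuous_insertSL _ _).continuousAt ?_ hv⟩
    have h1 : ∀ᶠ w in 𝓝 (dropSL ω z), insertSL z.snd.fst z.snd.snd.fst w ∈ inactiveSet g :=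
      (continuous_insertSL _ _).continuousAt.eventually (hU.mem_nhds hz)
    have h2 := eventually_neg_of_neg (w := dropSL ω z) hω
    filter_upwards [h1, h2] with w hw1 hw2
    have hw3 : w.snd.fst ∈ nonposOrthant m := fun i => (hw2 i).le
    exact ⟨(potential_eq_outerFn_dropSL hw1 hw3).symm,
      fun u hu => insertSL_mem_regularSubdiff hU hw1 hw3 hu⟩
  refine HasKLExponent.of_eventually (continuous_dropSL ω).continuousAt norm_dropSL_le ?_
    (isProper_potential hh.1.1 ⟨z, hne.some_mem.1⟩) hne hh
  filter_upwards [hU.mem_nhds hz] with z' hz'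
  refine ⟨potential_eq_outerFn_dropSL hz' hω', fun u hu =>
    mem_limitingSubdiff_of_eventually (continuous_dropSL ω).continuousAt
      (continuous_dropSL 0).continuousAt ?_ hu⟩
  filter_upwards [hU.mem_nhds hz'] with y hy
  exact ⟨potential_eq_outerFn_dropSL hy hω', fun u hu => dropSL_mem_regularSubdiff hU hy hω hu⟩

end Potential

end IMBA

end

theorem proposition4p8 {n m : ℕ} (f : IMBA.E n → EReal) (φ ψ : IMBA.E n → ℝ)
    (g : IMBA.E n → IMBA.E m) (hA : IMBA.BasicAssumption f φ ψ g)
    (p : IMBA.Params) (r : IMBA.Run f φ ψ g p)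
    (xbar sbar : IMBA.E n) (Lbar : IMBA.E m) (xibar : IMBA.E n)
    (hz : IMBA.mkZ xbar sbar Lbar xibar ∈ IMBA.clusterSet r)
    (hg : ContDiffAt ℝ 2 g xbar)
    (q : ℝ) (hq : q ∈ Set.Ico (1 / 2 : ℝ) 1)
    (hh : IMBA.HasKLExponent (IMBA.outerFn f φ ψ) q (IMBA.mkH xbar (g xbar) xibar))
    (hker : {u : IMBA.E n × IMBA.E m | u.1 + IMBA.gradMap g xbar u.2 = 0} ∩
        (Set.univ ×ˢ IMBA.normalCone (IMBA.nonposOrthant m) (g xbar)) = {(0, 0)}) :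
    IMBA.HasKLExponent (IMBA.potential f φ ψ g) q (IMBA.mkZ xbar sbar Lbar xibar) := by
  obtain ⟨rfl, hfeas, hL⟩ := r.cluster hA hz
  have hneg := IMBA.lt_zero_of_kernel hfeas hker
  have hmem : IMBA.mkZ xbar xbar Lbar xibar ∈ IMBA.inactiveSet g :=
    ⟨hL, fun i => by simpa [IMBA.mkZ, IMBA.Gmap_self] using hneg i⟩
  -- Here `ω = g x̄`, so that `dropSL ω` sends the cluster point by definition to the point where
  -- `h` has its KL exponent.
  exact IMBA.hasKLExponent_potential
    (IMBA.isOpen_inactiveSet hA.g_diff.continuous hA.g_lip.continuous) hmem hneg hh
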